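/- Let $n\ge 0$, $A\in\mathbb Q^{n\times n}$, $a,b\in\mathbb Q^n$, $c\in\mathbb Q$, and consider the single-guard affine loop $$\text{while } (g(x)\ge 0)\ \text{do } x:=f(x),\qquad f(x)=Ax+a,\quad g(x)=b^{\top}x+c .$$ Let $M=\begin{pmatrix}A&a\\0&1\end{pmatrix}$ and assume that $f$ is non-degenerate, i.e. no quotient of two distinct complex eigenvalues of $M$ is a root of unity. For $\mathbb D\in\{\mathbb R,\mathbb Q\}$ the loop is called non-terminating over $\mathbb D$ if there is $x\in\mathbb D^n$ with $g(f^m(x))\ge 0$ for all $m\in\mathbb N$. Let $\lambda_1,\dots,\lambda_s$ be the distinct non-zero complex eigenvalues of $M$, let $k_{\max}$ be the maximum of their algebraic multiplicities, and let $I=\{0,\dots,k_{\max}-1\}\times\{1,\dots,s\}$. Preorder $I$ by $(i_1,j_1)\preccurlyeq(i_2,j_2)$ iff $|\lambda_{j_1}|<|\lambda_{j_2}|$, or $|\lambda_{j_1}|=|\lambda_{j_2}|$ and $i_1\le i_2$, and let $\approx$ be the associated equivalence relation, whose classes are totally ordered by $\preccurlyeq$. Let $h_{i,j}:\mathbb R^n\to\mathbb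 C$, $(i,j)\in I$, be the unique affine functions such that $$g(f^m(x))=\sum_{(i,j)\in I}\binom{m}{i}\lambda_j^m\,h_{i,j}(x)\qquad\text{for all }x\in\mathbb R^n\text{ and all }m\ge n.$$ Put $\gamma_j=\lambda_j/|\lambda_j|$, $\mathbb T=\{z\in\mathbb C:|z|=1\}$ and $$T(\gamma)=\Big\{\mu\in\mathbb T^s:\ \prod_j\mu_j^{v_j}=1\ \text{ for every } v\in\mathbb Z^s \text{ with } \prod_j\gamma_j^{v_j}=1\Big\}.$$ For an $\approx$-class $E$, $x\in\mathbb R^n$ and $\mu\in T(\gamma)$ let $\Phi_E(x,\mu)=\sum_{(i,j)\in E}h_{i,j}(x)\mu_j$, which is a real number. Call $E$ dominant for $x$ if $h_{i,j}(x)=0$ for all $(i,j)$ in classes strictly above $E$. The set of potentially non-terminating points is $$\mathit{PN}=\Big\{x\in\mathbb R^n:\ \inf_{\mu\in T(\gamma)}\Phi_E(x,\mu)\ge 0\ \text{ for every class } E \text{ that is dominant for } x\Big\}.$$ Then the loop is non-terminating over $\mathbb R$ if and only if $\mathit{PN}$ is non-empty, and it is non-terminating over $\mathbb Q$ if and only if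 $\mathit{PN}$ contains a point of $\mathbb Q^n$. -/

import Mathlib

open Matrix

/-- The affine loop `while bᵀ x + c ≥ 0 do x := A x + a` in `n` variables, with a single guard and
rational coefficients. -/
structure AffineLoop (n : ℕ) where
  /-- linear part of the update function -/
  A : Matrix (Fin n) (Fin n) ℚ
  /-- constant part of the update function -/
  a : Fin n → ℚ
  /-- linear part of the guard function -/
  b : Fin n → ℚ
  /-- constant part of the guard function -/
  c : ℚ

namespace AffineLoop

section Semantics

variable {n : ℕ} (L : AffineLoop n)

/-- The update function `f x = A x + a` on `ℝⁿ`. -/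
def update (x : Fin n → ℝ) : Fin n → ℝ :=
  (L.A.map (fun q : ℚ => (q : ℝ))) *ᵥ x + fun i => (L.a i : ℝ)

/-- The guard function `g x = bᵀ x + c` on `ℝⁿ`. -/
def guard (x : Fin n → ℝ) : ℝ :=
  (fun i => (L.b i : ℝ)) ⬝ᵥ x + (L.c : ℝ)

/-- The initial value `x` is terminating: the guard fails after some number `m` of iterations. -/
def IsTerminating (x : Fin n → ℝ) : Prop :=
  ∃ m : ℕ, L.guard (L.update^[m] x) < 0

/-- The loop is non-terminating over the subring `D` of `ℝ`: some initial value with all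
coordinates in `D` is not terminating. -/
def NonTerminatingOver (D : Subring ℝ) : Prop :=
  ∃ x : Fin n → ℝ, (∀ i, x i ∈ D) ∧ ¬ L.IsTerminating x

/-- The update matrix `(A a; 0 1)`. -/
def updateMatrix : Matrix (Fin n ⊕ Unit) (Fin n ⊕ Unit) ℚ :=
  Matrix.fromBlocks L.A (Matrix.replicateCol Unit L.a) 0 1

/-- The update matrix, regarded as a complex matrix. -/
noncomputable def complexMatrix : Matrix (Fin n ⊕ Unit) (Fin n ⊕ Unit) ℂ :=
  L.updateMatrix.map (fun q : ℚ => (q : ℂ))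

/-- The update function is non-degenerate: no quotient of two distinct (complex) eigenvalues of the
update matrix is a root of unity. -/
def NonDegenerate : Prop :=
  ∀ z ∈ L.complexMatrix.charpoly.roots, ∀ w ∈ L.complexMatrix.charpoly.roots, z ≠ w →
    ∀ k : ℕ, 0 < k → (z / w) ^ k ≠ 1

/-- The finite set of the distinct non-zero complex eigenvalues of the update matrix. -/
noncomputable def eigs : Finset ℂ :=
  L.complexMatrix.charpoly.roots.toFinset.erase 0

/-- The maximal algebraic multiplicity of a non-zero eigenvalue of the update matrix. -/
noncomputable def kmax : ℕ :=
  L.eigs.sup fun z => L.complexMatrix.charpoly.rootMultiplicity z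

/-- The index set `I = {0, …, kmax - 1} × {non-zero eigenvalues}`; the eigenvalues are indexed by
themselves. -/
def Idx : Type := Fin L.kmax × L.eigs

noncomputable instance : Fintype L.Idx := inferInstanceAs (Fintype (Fin L.kmax × L.eigs))

/-- The exponent component `i` of an index `(i, j)`. -/
def Idx.exp {L : AffineLoop n} (p : L.Idx) : ℕ := (Prod.fst p : Fin L.kmax).val

/-- The eigenvalue component of an index `(i, j)`. -/
def Idx.eig {L : AffineLoop n} (p : L.Idx) : L.eigs := Prod.snd p

/-- The dominance preorder: `(i₁, j₁) ≤ (i₂, j₂)` iff `|λ_{j₁}| < |λ_{j₂}|`, or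
`|λ_{j₁}| = |λ_{j₂}|` and `i₁ ≤ i₂`. -/
noncomputable instance : Preorder L.Idx where
  le p q := ‖(p.eig : ℂ)‖ < ‖(q.eig : ℂ)‖ ∨ (‖(p.eig : ℂ)‖ = ‖(q.eig : ℂ)‖ ∧ p.exp ≤ q.exp)
  le_refl p := Or.inr ⟨rfl, le_rfl⟩
  le_trans p q r := by
    rintro (h | ⟨h, h'⟩) (k | ⟨k, k'⟩)
    · exact Or.inl (h.trans k)
    · exact Or.inl (k ▸ h)
    · exact Or.inl (h ▸ k)
    · exact Or.inr ⟨h.trans k, h'.trans k'⟩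

/-- The equivalence classes of the relation `p ≤ q ∧ q ≤ p` on the index set, with the partial
order induced by the dominance preorder. -/
abbrev IdxClass : Type := Antisymmetrization L.Idx (· ≤ ·)

/-- The equivalence class of an index. -/
def Idx.cls {L : AffineLoop n} (p : L.Idx) : L.IdxClass := toAntisymmetrization (· ≤ ·) p

end Semantics

section Expansion

/-- A generalised eigenvector is killed by the power of `T - μ` given by the algebraic multiplicity
of `μ`. -/
theorem pow_rootMultiplicity_apply_eq_zero {V : Type*} [AddCommGroup V] [Module ℂ V]
    [FiniteDimensional ℂ V] (T : Module.End ℂ V) (μ : ℂ) (v : V) (hv : v ∈ T.maxGenEigenspace μ) :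
    ((T - algebraMap ℂ (Module.End ℂ V) μ) ^ T.charpoly.rootMultiplicity μ) v = 0 := by
  have hm : ∀ x ∈ T.maxGenEigenspace μ,
      (T - algebraMap ℂ (Module.End ℂ V) μ) x ∈ T.maxGenEigenspace μ :=
    Module.End.mapsTo_maxGenEigenspace_of_comm (Algebra.mul_sub_algebraMap_commutes T μ) μ
  have hn := Module.End.isNilpotent_restrict_maxGenEigenspace_sub_algebraMap T μ hm
  have h1 := IsNilpotent.charpoly_eq_X_pow_finrank hn
  have h2 := LinearMap.aeval_self_charpoly
    ((T - algebraMap ℂ (Module.End ℂ V) μ).restrict hm)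
  rw [h1, LinearMap.finrank_maxGenEigenspace_eq] at h2
  simp only [map_pow, Polynomial.aeval_X] at h2
  rw [Module.End.pow_restrict] at h2
  have h3 := congrArg (fun g => ((g ⟨v, hv⟩ : T.maxGenEigenspace μ) : V)) h2
  simpa using h3

/-- Closed form of `m ↦ wᵀ Mᵐ v` as an exponential polynomial. -/
theorem exists_expansion_vec {N : Type*} [Fintype N] [DecidableEq N] (M : Matrix N N ℂ) (r k : ℕ)
    (hr : M.charpoly.rootMultiplicity 0 ≤ r)
    (hk : ∀ z ∈ M.charpoly.roots.toFinset.erase 0, M.charpoly.rootMultiplicity z ≤ k)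
    (w v : N → ℂ) :
    ∃ c : ℕ → ℂ → ℂ, ∀ m, r ≤ m → w ⬝ᵥ ((M ^ m) *ᵥ v) =
      ∑ z ∈ M.charpoly.roots.toFinset.erase 0, ∑ i ∈ Finset.range k,
        (m.choose i : ℂ) * z ^ m * c i z := by
  classical
  set T : Module.End ℂ (N → ℂ) := Matrix.toLin' M with hT
  have hTp : T.charpoly = M.charpoly := by
    rw [hT]; exact Matrix.charpoly_toLin' M
  have hpow : ∀ (m : ℕ) (v : N → ℂ), (M ^ m) *ᵥ v = (T ^ m) v := by
    intro m v
    rw [hT, ← Matrix.toLin'_pow, Matrix.toLin'_apply]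
  have hmem : v ∈ ⨆ μ, T.maxGenEigenspace μ := by
    rw [Module.End.iSup_maxGenEigenspace_eq_top]; trivial
  induction hmem using Submodule.iSup_induction' with
  | zero => exact ⟨0, fun m _ => by simp⟩
  | add x y _ _ hx hy =>
    obtain ⟨c, hc⟩ := hx
    obtain ⟨d, hd⟩ := hy
    refine ⟨c + d, fun m hm => ?_⟩
    rw [Matrix.mulVec_add, dotProduct_add, hc m hm, hd m hm]
    simp only [Pi.add_apply, mul_add, Finset.sum_add_distrib]
  | mem μ x hx =>
    have hz := pow_rootMultiplicity_apply_eq_zero T μ x hx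
    rw [hTp] at hz
    have hz' : ∀ i, M.charpoly.rootMultiplicity μ ≤ i →
        ((T - algebraMap ℂ (Module.End ℂ (N → ℂ)) μ) ^ i) x = 0 := by
      intro i hi
      obtain ⟨j, rfl⟩ := Nat.exists_eq_add_of_le hi
      rw [add_comm, pow_add, Module.End.mul_apply, hz, map_zero]
    by_cases hμ0 : μ = 0
    · refine ⟨0, fun m hm => ?_⟩
      have := hz' m (by rw [hμ0]; exact hr.trans hm)
      rw [hμ0, map_zero, sub_zero] at this
      rw [hpow, this]; simp
    by_cases hμ : μ ∈ M.charpoly.roots.toFinset.erase 0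
    · refine ⟨fun i z => if z = μ then
        (μ ^ i)⁻¹ * (w ⬝ᵥ (((T - algebraMap ℂ (Module.End ℂ (N → ℂ)) μ) ^ i) x)) else 0,
        fun m _ => ?_⟩
      set D := T - algebraMap ℂ (Module.End ℂ (N → ℂ)) μ with hD
      have hTD : T = D + algebraMap ℂ (Module.End ℂ (N → ℂ)) μ := by rw [hD]; abel
      have hcomm : Commute D (algebraMap ℂ (Module.End ℂ (N → ℂ)) μ) :=
        (Algebra.commutes μ D).symm
      have hexp : w ⬝ᵥ ((T ^ m) x) = ∑ i ∈ Finset.range (m + 1),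
          (m.choose i : ℂ) * μ ^ m * ((μ ^ i)⁻¹ * (w ⬝ᵥ ((D ^ i) x))) := by
        rw [hTD, hcomm.add_pow, LinearMap.sum_apply, dotProduct_sum]
        refine Finset.sum_congr rfl fun i hi => ?_
        have hi' : i ≤ m := Nat.lt_succ_iff.mp (Finset.mem_range.mp hi)
        have e1 : (D ^ i * (algebraMap ℂ (Module.End ℂ (N → ℂ)) μ) ^ (m - i) *
            ((m.choose i : ℕ) : Module.End ℂ (N → ℂ))) x
            = ((m.choose i : ℂ) * μ ^ (m - i)) • (D ^ i) x := by
          rw [← map_pow, ← map_natCast (algebraMap ℂ (Module.End ℂ (N → ℂ))), mul_assoc,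
            ← map_mul, Module.End.mul_apply, Module.algebraMap_end_apply, map_smul,
            mul_comm]
        rw [e1, dotProduct_smul, smul_eq_mul, pow_sub₀ μ hμ0 hi']
        ring
      rw [hpow, hexp, Finset.sum_eq_single_of_mem μ hμ]
      · simp only [if_true]
        have key : ∀ s : Finset ℕ, s ⊆ Finset.range (max (m + 1) k) →
            (∀ i ∉ s, (m.choose i : ℂ) * μ ^ m * ((μ ^ i)⁻¹ * (w ⬝ᵥ ((D ^ i) x))) = 0) →
            ∑ i ∈ s, (m.choose i : ℂ) * μ ^ m * ((μ ^ i)⁻¹ * (w ⬝ᵥ ((D ^ i) x))) =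
            ∑ i ∈ Finset.range (max (m + 1) k),
              (m.choose i : ℂ) * μ ^ m * ((μ ^ i)⁻¹ * (w ⬝ᵥ ((D ^ i) x))) :=
          fun s hs h => Finset.sum_subset hs fun i _ hi => h i hi
        rw [key (Finset.range (m + 1)), key (Finset.range k)]
        · exact Finset.range_subset_range.mpr (le_max_right _ _)
        · intro i hi
          have hi' : k ≤ i := by simpa using hi
          rw [hz' i ((hk μ hμ).trans hi')]; simp
        · exact Finset.range_subset_range.mpr (le_max_left _ _)
        · intro i hi
          have hi' : m < i := by simpa using hi
          rw [Nat.choose_eq_zero_of_lt hi']; simp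
      · intro z _ hz1
        simp [hz1]
    · have hroot : M.charpoly.rootMultiplicity μ = 0 := by
        by_contra hne
        apply hμ
        rw [Finset.mem_erase, Multiset.mem_toFinset, ← Multiset.count_pos,
          Polynomial.count_roots]
        exact ⟨hμ0, Nat.pos_of_ne_zero hne⟩
      have hx0 : x = 0 := by
        have := hz' 0 hroot.le
        simpa using this
      exact ⟨0, fun m _ => by simp [hx0]⟩

/-- Linear independence of the functions `m ↦ choose m i * z ^ m`, tested on `m ≥ r` only. -/
theorem expansion_coeff_eq_zero (Λ : Finset ℂ) (h0 : (0 : ℂ) ∉ Λ) (r k : ℕ) (c : ℕ → ℂ → ℂ)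
    (h : ∀ m, r ≤ m → ∑ z ∈ Λ, ∑ i ∈ Finset.range k, (m.choose i : ℂ) * z ^ m * c i z = 0) :
    ∀ z ∈ Λ, ∀ i < k, c i z = 0 := by
  classical
  let S : Module.End ℂ (ℕ → ℂ) := LinearMap.funLeft ℂ ℂ Nat.succ
  have hS : ∀ (z : ℂ) (u : ℕ → ℂ) (m : ℕ),
      (S - z • (1 : Module.End ℂ (ℕ → ℂ))) u m = u (m + 1) - z * u m := fun z u m => by
    simp [S, LinearMap.funLeft_apply]
  have hp : ∀ (z : ℂ) (i : ℕ),
      (fun m : ℕ => (m.choose i : ℂ) * z ^ m) ∈ S.maxGenEigenspace z := by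
    intro z i
    induction i with
    | zero =>
      rw [Module.End.mem_maxGenEigenspace]
      refine ⟨1, ?_⟩
      rw [pow_one]
      ext m
      rw [hS]; simp [pow_succ]; ring
    | succ i ih =>
      have h1 : (S - z • (1 : Module.End ℂ (ℕ → ℂ))) (fun m : ℕ => (m.choose (i + 1) : ℂ) * z ^ m)
          = z • (fun m : ℕ => (m.choose i : ℂ) * z ^ m) := by
        ext m
        rw [hS, Nat.choose_succ_succ]
        simp [pow_succ]; ring
      obtain ⟨j, hj⟩ := (Module.End.mem_maxGenEigenspace _ _ _).mp
        ((S.maxGenEigenspace z).smul_mem z ih)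
      refine (Module.End.mem_maxGenEigenspace _ _ _).mpr ⟨j + 1, ?_⟩
      rw [pow_succ, Module.End.mul_apply, h1, hj]
  let F : ℂ → ℕ → ℂ := fun z m => ∑ i ∈ Finset.range k, (m.choose i : ℂ) * z ^ m * c i z
  have hF : ∀ z, F z ∈ S.maxGenEigenspace z := by
    intro z
    have : F z = ∑ i ∈ Finset.range k, c i z • (fun m : ℕ => (m.choose i : ℂ) * z ^ m) := by
      ext m
      simp [F, Finset.sum_apply, mul_comm]
    rw [this]
    exact Submodule.sum_mem _ fun i _ => Submodule.smul_mem _ _ (hp z i)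
  let e : ℕ → ℂ := -∑ z ∈ Λ, F z
  have he : e ∈ S.maxGenEigenspace 0 := by
    refine (Module.End.mem_maxGenEigenspace _ _ _).mpr ⟨r, ?_⟩
    have hit : ∀ (j : ℕ) (u : ℕ → ℂ) (m : ℕ),
        ((S - (0 : ℂ) • (1 : Module.End ℂ (ℕ → ℂ))) ^ j) u m = u (m + j) := by
      intro j
      induction j with
      | zero => intro u m; simp
      | succ j ih =>
        intro u m
        rw [pow_succ, Module.End.mul_apply, ih, hS]
        simp [add_assoc]
    ext m
    rw [hit]
    have := h (m + r) (Nat.le_add_left _ _)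
    simp only [e, F, Pi.neg_apply, Finset.sum_apply, Pi.zero_apply, this, neg_zero]
  let G : ℂ → ℕ → ℂ := fun z => if z = 0 then e else F z
  have hG : ∀ z ∈ insert 0 Λ, G z ∈ S.maxGenEigenspace z := by
    intro z _
    by_cases hz : z = 0
    · simp only [G, hz, if_true]; exact he
    · simp only [G, hz, if_false]; exact hF z
  have hsum : ∑ z ∈ insert 0 Λ, G z = 0 := by
    rw [Finset.sum_insert h0]
    have : ∑ z ∈ Λ, G z = ∑ z ∈ Λ, F z := Finset.sum_congr rfl fun z hz => by
      have : z ≠ 0 := fun h => h0 (h ▸ hz)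
      simp [G, this]
    rw [this]; simp [G, e]
  have hzero := (iSupIndep_iff_finsetSum_eq_zero_imp_eq_zero (S.maxGenEigenspace)).mp
    S.independent_maxGenEigenspace (insert 0 Λ) G hG hsum
  intro z hz
  have hz0 : z ≠ 0 := fun h => h0 (h ▸ hz)
  have hFz : F z = 0 := by simpa [G, hz0] using hzero z (Finset.mem_insert_of_mem hz)
  intro i
  induction i using Nat.strong_induction_on with
  | _ i ih =>
    intro hi
    have h1 : F z i = 0 := by rw [hFz]; rfl
    simp only [F] at h1
    rw [Finset.sum_eq_single_of_mem i (Finset.mem_range.mpr hi)] at h1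
    · simpa [hz0] using h1
    · intro j hj hne
      rcases lt_or_gt_of_ne hne with hlt | hgt
      · rw [ih j hlt (Finset.mem_range.mp hj), mul_zero]
      · rw [Nat.choose_eq_zero_of_lt hgt]; simp

variable {n : ℕ} (L : AffineLoop n)

/-- The homogenisation `(x, 1)` of a real point, as a complex vector. -/
noncomputable def homog (x : Fin n → ℝ) : Fin n ⊕ Unit → ℂ :=
  Sum.elim (fun i => (x i : ℂ)) (fun _ => 1)

/-- The guard vector `(bᵀ c)`, as a complex vector. -/
noncomputable def guardVec : Fin n ⊕ Unit → ℂ :=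
  Sum.elim (fun i => (L.b i : ℂ)) (fun _ => (L.c : ℂ))

theorem homog_update (x : Fin n → ℝ) : homog (L.update x) = L.complexMatrix *ᵥ homog x := by
  ext (i | i)
  · simp [homog, update, complexMatrix, updateMatrix, Matrix.mulVec, dotProduct]
  · simp [homog, complexMatrix, updateMatrix, Matrix.mulVec, dotProduct]

theorem guard_iterate (x : Fin n → ℝ) (m : ℕ) :
    (L.guard (L.update^[m] x) : ℂ) = L.guardVec ⬝ᵥ ((L.complexMatrix ^ m) *ᵥ homog x) := by
  have h : homog (L.update^[m] x) = (L.complexMatrix ^ m) *ᵥ homog x := by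
    induction m with
    | zero => simp
    | succ m ih =>
      rw [Function.iterate_succ_apply', homog_update, ih, Matrix.mulVec_mulVec, pow_succ']
  rw [← h]
  simp [guard, guardVec, homog, dotProduct]

theorem rootMultiplicity_zero_le : L.complexMatrix.charpoly.rootMultiplicity 0 ≤ n := by
  have h : L.complexMatrix.charpoly =
      (L.A.map (fun q : ℚ => (q : ℂ))).charpoly * (Polynomial.X - 1) := by
    rw [complexMatrix, updateMatrix, Matrix.fromBlocks_map]
    rw [Matrix.charpoly, Matrix.charmatrix_fromBlocks]
    simp [Matrix.charpoly, Matrix.det_fromBlocks_zero₂₁, Matrix.charmatrix]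
  rw [h, Polynomial.rootMultiplicity_mul (by
    rw [← h]; exact (Matrix.charpoly_monic _).ne_zero)]
  have h1 : (Polynomial.X - 1 : Polynomial ℂ).rootMultiplicity 0 = 0 :=
    Polynomial.rootMultiplicity_eq_zero (by simp [Polynomial.IsRoot])
  rw [h1, add_zero]
  rw [← Polynomial.count_roots]
  refine (Multiset.count_le_card _ _).trans ((Polynomial.card_roots' _).trans ?_)
  rw [Matrix.charpoly_natDegree_eq_dim, Fintype.card_fin]

theorem sum_idx (F : ℕ → ℂ → ℂ) :
    ∑ p : L.Idx, F p.exp p.eig = ∑ z ∈ L.eigs, ∑ i ∈ Finset.range L.kmax, F i z := by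
  calc ∑ p : L.Idx, F p.exp p.eig = ∑ p : Fin L.kmax × L.eigs, F p.1 p.2 := rfl
    _ = ∑ z : L.eigs, ∑ i : Fin L.kmax, F i z := Fintype.sum_prod_type_right _
    _ = ∑ z : L.eigs, ∑ i ∈ Finset.range L.kmax, F i z :=
      Finset.sum_congr rfl fun z _ => Fin.sum_univ_eq_sum_range (fun i => F i z) _
    _ = ∑ z ∈ L.eigs, ∑ i ∈ Finset.range L.kmax, F i z :=
      Finset.sum_coe_sort L.eigs (fun z => ∑ i ∈ Finset.range L.kmax, F i z)

/-- The family `h` of affine functions `h_{i,j} : ℝⁿ → ℂ` satisfies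
`g (fᵐ x) = ∑_{(i,j) ∈ I} (m choose i) λ_jᵐ h_{i,j} x` for all `x ∈ ℝⁿ` and all `m ≥ n`. -/
def IsExpansion (h : L.Idx → ((Fin n → ℝ) →ᵃ[ℝ] ℂ)) : Prop :=
  ∀ (x : Fin n → ℝ) (m : ℕ), n ≤ m →
    (L.guard (L.update^[m] x) : ℂ) =
      ∑ p : L.Idx, (m.choose p.exp : ℂ) * (p.eig : ℂ) ^ m * h p x

theorem existsUnique_isExpansion : ∃! h, L.IsExpansion h := by
  classical
  refine existsUnique_of_exists_of_unique ?_ ?_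
  · have hv : ∀ v : Fin n ⊕ Unit → ℂ, ∃ c : ℕ → ℂ → ℂ, ∀ m, n ≤ m →
        L.guardVec ⬝ᵥ ((L.complexMatrix ^ m) *ᵥ v) =
        ∑ z ∈ L.eigs, ∑ i ∈ Finset.range L.kmax, (m.choose i : ℂ) * z ^ m * c i z :=
      fun v => exists_expansion_vec L.complexMatrix n L.kmax L.rootMultiplicity_zero_le
        (fun z hz => Finset.le_sup (f := fun z => L.complexMatrix.charpoly.rootMultiplicity z) hz)
        L.guardVec v
    choose c hc using fun k : Fin n ⊕ Unit => hv (Pi.single k 1)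
    refine ⟨fun p =>
      (∑ k : Fin n, (LinearMap.proj k : (Fin n → ℝ) →ₗ[ℝ] ℝ).smulRight
        (c (Sum.inl k) p.exp p.eig)).toAffineMap +
        AffineMap.const ℝ (Fin n → ℝ) (c (Sum.inr ()) p.exp p.eig), fun x m hm => ?_⟩
    have hx : homog x = ∑ k : Fin n ⊕ Unit, homog x k • (Pi.single k (1 : ℂ)) := by
      ext k
      simp [Finset.sum_apply, Pi.single_apply]
    rw [guard_iterate, hx, Matrix.mulVec_sum, dotProduct_sum]
    simp only [Matrix.mulVec_smul, dotProduct_smul]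
    simp only [hc _ m hm, ← L.sum_idx (fun i z => (m.choose i : ℂ) * z ^ m * c _ i z)]
    rw [Fintype.sum_sum_type]
    simp only [homog, Sum.elim_inl, Sum.elim_inr, smul_eq_mul, Finset.univ_unique,
      Finset.sum_singleton, one_mul, AffineMap.coe_add, Pi.add_apply, LinearMap.coe_toAffineMap,
      LinearMap.sum_apply, LinearMap.smulRight_apply, LinearMap.proj_apply, AffineMap.coe_const,
      Function.const_apply, Complex.real_smul, mul_add, Finset.sum_add_distrib, Finset.mul_sum]
    rw [Finset.sum_comm]
    congr 1
    refine Finset.sum_congr rfl fun p _ => Finset.sum_congr rfl fun k _ => ?_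
    ring
  · intro h h' H H'
    funext p
    ext x
    let d : ℕ → ℂ → ℂ := fun i z =>
      if hq : i < L.kmax ∧ z ∈ L.eigs then
        h ((⟨i, hq.1⟩, ⟨z, hq.2⟩) : Fin L.kmax × L.eigs) x -
        h' ((⟨i, hq.1⟩, ⟨z, hq.2⟩) : Fin L.kmax × L.eigs) x else 0
    have hd : ∀ q : L.Idx, d q.exp q.eig = h q x - h' q x := by
      intro q
      have hq : q.exp < L.kmax ∧ (q.eig : ℂ) ∈ L.eigs := ⟨(Prod.fst q : Fin L.kmax).2, q.eig.2⟩
      simp only [d, dif_pos hq]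
      rfl
    have key := expansion_coeff_eq_zero L.eigs (by simp [eigs]) n L.kmax d (fun m hm => by
      rw [← L.sum_idx (fun i z => (m.choose i : ℂ) * z ^ m * d i z)]
      simp only [hd, mul_sub, Finset.sum_sub_distrib]
      rw [← H x m hm, ← H' x m hm, sub_self])
    have := key p.eig p.eig.2 p.exp (Prod.fst p : Fin L.kmax).2
    rw [hd] at this
    exact sub_eq_zero.mp this

/-- The affine functions `h_{i,j} : ℝⁿ → ℂ`, i.e. the unique family of affine functions with
`g (fᵐ x) = ∑_{(i,j) ∈ I} (m choose i) λ_jᵐ h_{i,j} x` for all `x ∈ ℝⁿ` and all `m ≥ n`. -/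
noncomputable def coeff : L.Idx → ((Fin n → ℝ) →ᵃ[ℝ] ℂ) :=
  L.existsUnique_isExpansion.choose

theorem coeff_isExpansion : L.IsExpansion L.coeff :=
  L.existsUnique_isExpansion.choose_spec.1

end Expansion

section PotentiallyNonTerminating

variable {n : ℕ} (L : AffineLoop n)

theorem eig_ne_zero (z : L.eigs) : (z : ℂ) ≠ 0 := (Finset.mem_erase.mp z.2).1

/-- The normalised eigenvalues `γ_j = λ_j / |λ_j|`, as elements of the unit circle. -/
noncomputable def gam (z : L.eigs) : Circle :=
  ⟨(z : ℂ) / (‖(z : ℂ)‖ : ℂ), by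
    have h : ‖(z : ℂ)‖ ≠ 0 := norm_ne_zero_iff.mpr (L.eig_ne_zero z)
    simp [Submonoid.unitSphere, h]⟩

/-- The group of multiplicative relations among the normalised eigenvalues. -/
def relations : Set (L.eigs → ℤ) :=
  {v | ∏ z, L.gam z ^ v z = 1}

/-- The set `T(γ)` of the points of the torus that satisfy every multiplicative relation among the
normalised eigenvalues. -/
def torus : Set (L.eigs → Circle) :=
  {μ | ∀ v ∈ L.relations, ∏ z, μ z ^ v z = 1}

open Classical in
/-- `Φ_E (x, μ) = ∑_{(i,j) ∈ E} h_{i,j} x * μ_j`. For `μ ∈ T(γ)` this sum is a real number, because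
complex conjugate eigenvalues contribute complex conjugate terms. -/
noncomputable def Phi (E : L.IdxClass) (x : Fin n → ℝ) (μ : L.eigs → Circle) : ℝ :=
  (∑ p : L.Idx with p.cls = E, L.coeff p x * (μ p.eig : ℂ)).re

/-- The class `E` is dominant for `x`: `h_{i,j} x = 0` for all `(i, j)` in a class above `E`. -/
def IsDominant (E : L.IdxClass) (x : Fin n → ℝ) : Prop :=
  ∀ p : L.Idx, E < p.cls → L.coeff p x = 0

/-- The set of potentially non-terminating points: those `x` with
`inf_{μ ∈ T(γ)} Φ_E (x, μ) ≥ 0` for every class `E` that is dominant for `x`. (If `E` is dominant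
for `x` and not the least such class, then `Φ_E (x, ·)` vanishes, so that the condition concerns
the least dominant class.) -/
def PN : Set (Fin n → ℝ) :=
  {x | ∀ E : L.IdxClass, L.IsDominant E x → 0 ≤ ⨅ μ : L.torus, L.Phi E x μ}

end PotentiallyNonTerminating

end AffineLoop

/-! Let `E` be a class dominant for `x`. Dividing the expansion of `g(f^m(x))` by the growth rate
`binom(m,i) |λ|^m` of `E` leaves `Φ_E(x, γ^m) + o(1)` (`tendsto_guard_div_scale_sub`). By
Kronecker's theorem every point of `T(γ)` is a cluster point of the powers `γ^m`
(`Circle.mapClusterPt_pow`). If the guard never fails, each value of `Φ_E(x, ·)` on `T(γ)` is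
therefore a cluster value of non-negative numbers, so `x` itself lies in `PN`.

Conversely, let `x` be in `PN`. If all coefficients vanish at `x`, the guard is eventually zero.
Otherwise take the highest class with a non-zero coefficient. There `Φ ≥ 0` on `T(γ)`, but `Φ` may
have zeros, near which lower-order terms could make the guard negative, so `x` itself may fail. The
remedy is to replace `x` by the average of `x, f(x), …, f^(K-1)(x)`. As `f` and `g` are affine, the
guard along the new orbit is an average of shifted guards, governed by `∑_{k<K} |λ|^k Φ(x, γ^k μ)`
at `μ = γ^m`. Since `Φ` is not identically zero and the powers of `γ` are dense in `T(γ)`,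
compactness gives a `K` for which this sum is positive on all of `T(γ)`
(`exists_forall_exists_Phi_pos`). Its minimum then beats the error (`eventually_sum_guard_pos`), and
a late iterate of the average never terminates. Averaging and iterating use only rational
operations, so the argument works over any subring of `ℝ` containing `ℚ`. -/

open Filter Topology MeasureTheory

/-! ### Kronecker's approximation theorem -/

namespace UnitAddTorus

variable {d : Type*} [Fintype d]

theorem mFourier_apply_add (v : d → ℤ) (x y : UnitAddTorus d) :
    mFourier v (x + y) = mFourier v x * mFourier v y := by
  simp only [mFourier, ContinuousMap.coe_mk, ← Finset.prod_mul_distrib]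
  refine Finset.prod_congr rfl fun i _ => ?_
  simp [fourier_apply, smul_add, AddCircle.toCircle_add]

/-- Kronecker's approximation theorem: a point of the torus that satisfies every character relation
of `t` belongs to the closed subgroup generated by `t`. -/
theorem mem_topologicalClosure_zmultiples {t τ : UnitAddTorus d}
    (h : ∀ v : d → ℤ, mFourier v t = 1 → mFourier v τ = 1) :
    τ ∈ (AddSubgroup.zmultiples t).topologicalClosure := by
  set H := (AddSubgroup.zmultiples t).topologicalClosure with hH
  have hHc : IsClosed (H : Set (UnitAddTorus d)) := AddSubgroup.isClosed_topologicalClosure _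
  have htH : t ∈ H := AddSubgroup.le_topologicalClosure _ (AddSubgroup.mem_zmultiples t)
  by_contra hτ
  let _ : MeasurableSpace H := borel H
  have : BorelSpace H := ⟨rfl⟩
  have : CompactSpace H := isCompact_iff_compactSpace.mp hHc.isCompact
  let ν : Measure H := Measure.addHaarMeasure ⊤
  have : IsProbabilityMeasure ν := ⟨by
    have := Measure.addHaarMeasure_self (K₀ := (⊤ : TopologicalSpace.PositiveCompacts H))
    simpa using this⟩
  have hint : ∀ (σ : UnitAddTorus d) (f : C(UnitAddTorus d, ℂ)),
      Integrable (fun x : H => f (σ + x)) ν := fun σ f =>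
    (by fun_prop : Continuous fun x : H => f (σ + x)).integrable_of_hasCompactSupport
      (HasCompactSupport.of_compactSpace _)
  -- Trigonometric polynomials have the same Haar average over `τ + H` as over `H`. A character
  -- trivial at `t` is trivial at `τ` by hypothesis; any other one has average zero over `H` by
  -- translation invariance.
  have hspan : ∀ P ∈ Submodule.span ℂ (Set.range (mFourier (d := d))),
      ∫ x : H, P (τ + x) ∂ν = ∫ x : H, P (0 + x) ∂ν := by
    intro P hP
    induction hP using Submodule.span_induction with
    | mem P hP =>
      obtain ⟨v, rfl⟩ := hP
      simp only [mFourier_apply_add, integral_const_mul]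
      by_cases hv : mFourier v t = 1
      · have h0 : mFourier v (0 : UnitAddTorus d) = 1 := by simp [mFourier]
        rw [h v hv, h0]
      · have h1 : ∫ x : H, mFourier v (x : UnitAddTorus d) ∂ν =
            mFourier v t * ∫ x : H, mFourier v (x : UnitAddTorus d) ∂ν := by
          rw [← integral_const_mul,
            ← integral_add_left_eq_self (fun x : H => mFourier v (x : UnitAddTorus d)) ⟨t, htH⟩]
          simp [mFourier_apply_add]
        have h2 : ∫ x : H, mFourier v (x : UnitAddTorus d) ∂ν = 0 := by
          by_contra hne
          exact hv (mul_right_cancel₀ hne (by rw [one_mul]; exact h1.symm))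
        rw [h2, mul_zero, mul_zero]
    | zero => simp
    | add P Q _ _ hP hQ =>
      simp only [ContinuousMap.add_apply]
      rw [integral_add (hint _ _) (hint _ _), integral_add (hint _ _) (hint _ _), hP, hQ]
    | smul c P _ hP =>
      simp only [ContinuousMap.smul_apply, integral_smul, hP]
  have hcl : IsClosed ((fun x => τ + x) '' (H : Set (UnitAddTorus d))) :=
    (Homeomorph.addLeft τ).isClosedMap _ hHc
  have hdisj : Disjoint (H : Set (UnitAddTorus d)) ((fun x => τ + x) '' H) := by
    rw [Set.disjoint_left]
    rintro _ hx ⟨y, hy, rfl⟩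
    exact hτ ((H.add_mem_cancel_right hy).mp hx)
  -- If `τ ∉ H`, the coset is disjoint from `H`, and a Urysohn function has averages 0 and 1. A
  -- trigonometric polynomial within 1/2 of it has equal averages, which is impossible.
  obtain ⟨g, hg0, hg1, -⟩ := exists_continuous_zero_one_of_isClosed hHc hcl hdisj
  let f : C(UnitAddTorus d, ℂ) := ⟨fun x => (g x : ℂ), by fun_prop⟩
  have hf : f ∈ (Submodule.span ℂ (Set.range (mFourier (d := d)))).topologicalClosure := by
    rw [span_mFourier_closure_eq_top]; trivial
  obtain ⟨P, hP, hPf⟩ := Metric.mem_closure_iff.mp hf (1 / 2) (by norm_num)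
  have hclose : ∀ σ, ‖∫ x : H, f (σ + x) ∂ν - ∫ x : H, P (σ + x) ∂ν‖ < 1 / 2 := by
    intro σ
    rw [← integral_sub (hint _ _) (hint _ _)]
    refine (norm_integral_le_of_norm_le_const (C := ‖f - P‖) (ae_of_all _ fun x => ?_)).trans_lt ?_
    · exact (f - P).norm_coe_le_norm _
    · simpa [dist_eq_norm] using hPf
  have e1 : ∫ x : H, f (τ + x) ∂ν = 1 := by
    have : ∀ x : H, f (τ + x) = 1 := fun x => by
      simp [f, hg1 (Set.mem_image_of_mem _ x.2)]
    simp [this]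
  have e0 : ∫ x : H, f (0 + x) ∂ν = 0 := by
    have : ∀ x : H, f (0 + x) = 0 := fun x => by
      simp [f, hg0 x.2]
    simp only [this, integral_zero]
  have k1 := hclose τ
  have k0 := hclose 0
  rw [e1, hspan P hP] at k1
  rw [e0] at k0
  have := norm_sub_le ((1 : ℂ) - ∫ x : H, P (0 + x) ∂ν) (0 - ∫ x : H, P (0 + x) ∂ν)
  simp only [sub_sub_sub_cancel_right, sub_zero, norm_one] at this
  linarith

end UnitAddTorus

/-- Kronecker's approximation theorem on a power of the circle group, with recurrence. -/
theorem Circle.mapClusterPt_pow {d : Type*} [Fintype d] {g μ : d → Circle}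
    (h : ∀ v : d → ℤ, ∏ i, g i ^ v i = 1 → ∏ i, μ i ^ v i = 1) :
    MapClusterPt μ atTop (fun m : ℕ => g ^ m) := by
  have hsurj : ∀ z : Circle, ∃ s : UnitAddCircle, s.toCircle = z := fun z =>
    ⟨(AddCircle.homeomorphCircle one_ne_zero).symm z, by
      rw [← AddCircle.homeomorphCircle_apply one_ne_zero, Homeomorph.apply_symm_apply]⟩
  choose t ht using fun i => hsurj (g i)
  choose τ hτ using fun i => hsurj (μ i)
  have hF : ∀ (s : UnitAddTorus d) (v : d → ℤ),
      UnitAddTorus.mFourier v s = ((∏ i, (s i).toCircle ^ v i : Circle) : ℂ) := by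
    intro s v
    refine Eq.trans ?_ (map_prod Circle.coeHom _ _).symm
    simp [UnitAddTorus.mFourier, fourier_apply, AddCircle.toCircle_zsmul]
    rfl
  have hmem : τ ∈ (AddSubgroup.zmultiples t).topologicalClosure :=
    UnitAddTorus.mem_topologicalClosure_zmultiples fun v hv => by
      rw [hF] at hv ⊢
      simp only [ht, hτ] at hv ⊢
      rw [h v (Circle.ext hv)]; rfl
  -- By compactness, positive multiples recur near every point of the closed subgroup, so negative
  -- multiples are not needed.
  have hc := mapClusterPt_atTop_nsmul_iff_mem_topologicalClosure_zmultiples.mpr hmem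
  have hcont : Continuous fun s : UnitAddTorus d => fun i => (s i).toCircle :=
    continuous_pi fun i => AddCircle.continuous_toCircle.comp (continuous_apply i)
  have := hc.continuousAt_comp hcont.continuousAt
  convert this using 1
  · ext1 i; exact (hτ i).symm
  · funext m i
    simp [AddCircle.toCircle_nsmul, ht]

/-! ### Comparison of the growth rates `binom(m,i) r^m` -/

theorem tendsto_choose_mul_pow_div_of_lt {r s : ℝ} (hr : 0 ≤ r) (hrs : r < s) (i j : ℕ) :
    Tendsto (fun m : ℕ => (m.choose i * r ^ m) / (m.choose j * s ^ m) : ℕ → ℝ) atTop (𝓝 0) := by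
  have hs : 0 < s := hr.trans_lt hrs
  have h0 : Tendsto (fun m : ℕ => (m : ℝ) ^ i * (r / s) ^ m) atTop (𝓝 0) :=
    tendsto_pow_const_mul_const_pow_of_lt_one i (by positivity) ((div_lt_one hs).mpr hrs)
  refine squeeze_zero' (Eventually.of_forall fun m => by positivity) ?_ h0
  filter_upwards [eventually_ge_atTop j] with m hm
  have h1 : (1 : ℝ) ≤ m.choose j := by exact_mod_cast Nat.choose_pos hm
  have h2 : (m.choose i : ℝ) ≤ (m : ℝ) ^ i := by exact_mod_cast Nat.choose_le_pow m i
  rw [div_pow, mul_div_assoc']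
  apply div_le_div₀ (by positivity) (by gcongr) (by positivity)
  exact le_mul_of_one_le_left (by positivity) h1

theorem tendsto_choose_div_choose_of_lt {i j : ℕ} (hij : i < j) :
    Tendsto (fun m : ℕ => (m.choose i : ℝ) / m.choose j) atTop (𝓝 0) := by
  have h := ((isEquivalent_choose i).div (isEquivalent_choose j))
  refine (h.tendsto_nhds_iff).mpr ?_
  have h1 : Tendsto (fun m : ℕ => (j.factorial / i.factorial : ℝ) * (((m : ℝ)⁻¹) ^ (j - i)))
      atTop (𝓝 0) := by
    have := (tendsto_inv_atTop_nhds_zero_nat (𝕜 := ℝ)).pow (j - i)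
    rw [zero_pow (by omega)] at this
    simpa using this.const_mul (j.factorial / i.factorial : ℝ)
  refine h1.congr' ?_
  filter_upwards [eventually_gt_atTop 0] with m hm
  have hm' : (m : ℝ) ≠ 0 := by positivity
  have : (m : ℝ) ^ j = (m : ℝ) ^ i * (m : ℝ) ^ (j - i) := by
    rw [← pow_add]; congr 1; omega
  simp only [Pi.div_apply, this, inv_pow]
  field_simp

theorem tendsto_choose_add_div_choose (i k : ℕ) :
    Tendsto (fun m : ℕ => ((m + k).choose i : ℝ) / m.choose i) atTop (𝓝 1) := by
  have h := ((isEquivalent_choose i).comp_tendsto (tendsto_add_atTop_nat k)).div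
    (isEquivalent_choose i)
  refine (h.tendsto_nhds_iff).mpr ?_
  have h1 : Tendsto (fun m : ℕ => (1 + (k : ℝ) * (m : ℝ)⁻¹) ^ i) atTop (𝓝 1) := by
    have := (((tendsto_inv_atTop_nhds_zero_nat (𝕜 := ℝ)).const_mul (k : ℝ)).const_add 1).pow i
    simpa using this
  refine h1.congr' ?_
  filter_upwards [eventually_gt_atTop 0] with m hm
  have hm' : (m : ℝ) ≠ 0 := by positivity
  have : (1 + (k : ℝ) * (m : ℝ)⁻¹) = (m + k) / m := by field_simp
  simp only [Pi.div_apply, Function.comp, this, div_pow]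
  push_cast
  field_simp

/-! ### Affine combinations of orbits -/

namespace AffineLoop

variable {n : ℕ} (L : AffineLoop n)

section Affine

theorem update_sum_smul {ι : Type*} (s : Finset ι) (w : ι → ℝ) (hw : ∑ i ∈ s, w i = 1)
    (x : ι → Fin n → ℝ) :
    L.update (∑ i ∈ s, w i • x i) = ∑ i ∈ s, w i • L.update (x i) := by
  simp only [update, Matrix.mulVec_sum, Matrix.mulVec_smul, smul_add, Finset.sum_add_distrib,
    ← Finset.sum_smul, hw, one_smul]

theorem iterate_update_sum_smul {ι : Type*} (s : Finset ι) (w : ι → ℝ) (hw : ∑ i ∈ s, w i = 1)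
    (x : ι → Fin n → ℝ) (m : ℕ) :
    L.update^[m] (∑ i ∈ s, w i • x i) = ∑ i ∈ s, w i • L.update^[m] (x i) := by
  induction m with
  | zero => simp
  | succ m ih => simp only [Function.iterate_succ_apply', ih, L.update_sum_smul s w hw]

theorem guard_sum_smul {ι : Type*} (s : Finset ι) (w : ι → ℝ) (hw : ∑ i ∈ s, w i = 1)
    (x : ι → Fin n → ℝ) :
    L.guard (∑ i ∈ s, w i • x i) = ∑ i ∈ s, w i * L.guard (x i) := by
  simp only [guard, dotProduct_sum, dotProduct_smul, smul_eq_mul, mul_add,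
    Finset.sum_add_distrib, ← Finset.sum_mul, hw, one_mul]

theorem update_mem {D : Subring ℝ} (hD : ∀ q : ℚ, (q : ℝ) ∈ D) {x : Fin n → ℝ}
    (hx : ∀ i, x i ∈ D) (i : Fin n) : L.update x i ∈ D := by
  simp only [update, Pi.add_apply, Matrix.mulVec, dotProduct, Matrix.map_apply]
  exact D.add_mem (D.sum_mem fun j _ => D.mul_mem (hD _) (hx j)) (hD _)

theorem iterate_update_mem {D : Subring ℝ} (hD : ∀ q : ℚ, (q : ℝ) ∈ D) {x : Fin n → ℝ}
    (hx : ∀ i, x i ∈ D) (m : ℕ) : ∀ i, L.update^[m] x i ∈ D := by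
  induction m with
  | zero => exact hx
  | succ m ih => rw [Function.iterate_succ_apply']; exact L.update_mem hD ih

/-- If the guard eventually holds along the orbit of a point over `D`, then some iterate of that
point witnesses non-termination over `D`. -/
theorem nonTerminatingOver_of_eventually {D : Subring ℝ} (hD : ∀ q : ℚ, (q : ℝ) ∈ D)
    {x : Fin n → ℝ} (hx : ∀ i, x i ∈ D) (h : ∀ᶠ m in atTop, 0 ≤ L.guard (L.update^[m] x)) :
    L.NonTerminatingOver D := by
  obtain ⟨N, hN⟩ := eventually_atTop.mp h
  refine ⟨L.update^[N] x, L.iterate_update_mem hD hx N, ?_⟩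
  rintro ⟨m, hm⟩
  rw [← Function.iterate_add_apply] at hm
  exact absurd (hN (m + N) (Nat.le_add_left _ _)) (not_le.mpr hm)

end Affine

/-! ### The dominance preorder and asymptotics of the guard -/

section Classes

variable {L}

theorem Idx.lt_or_le (p q : L.Idx) : p < q ∨ q ≤ p := by
  by_cases h : q ≤ p
  · exact Or.inr h
  refine Or.inl (lt_of_le_not_ge ?_ h)
  have h' : ¬ (‖(q.eig : ℂ)‖ < ‖(p.eig : ℂ)‖ ∨
    (‖(q.eig : ℂ)‖ = ‖(p.eig : ℂ)‖ ∧ q.exp ≤ p.exp)) := h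
  push Not at h'
  change ‖(p.eig : ℂ)‖ < ‖(q.eig : ℂ)‖ ∨ (‖(p.eig : ℂ)‖ = ‖(q.eig : ℂ)‖ ∧ p.exp ≤ q.exp)
  rcases h'.1.lt_or_eq with h1 | h1
  · exact Or.inl h1
  · exact Or.inr ⟨h1, (h'.2 h1.symm).le⟩

theorem Idx.cls_lt_cls {p q : L.Idx} : p.cls < q.cls ↔ p < q :=
  toAntisymmetrization_lt_toAntisymmetrization_iff

theorem Idx.cls_eq_cls {p q : L.Idx} : p.cls = q.cls ↔ p ≤ q ∧ q ≤ p :=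
  Quotient.eq (r := AntisymmRel.setoid L.Idx (· ≤ ·))

theorem Idx.norm_eq_of_cls_eq {p q : L.Idx} (h : p.cls = q.cls) :
    ‖(p.eig : ℂ)‖ = ‖(q.eig : ℂ)‖ := by
  obtain ⟨h1 | h1, h2 | h2⟩ := Idx.cls_eq_cls.mp h
  · exact absurd h1 h2.not_gt
  · exact h2.1.symm
  · exact h1.1
  · exact h1.1

theorem Idx.exp_eq_of_cls_eq {p q : L.Idx} (h : p.cls = q.cls) : p.exp = q.exp := by
  have hn := Idx.norm_eq_of_cls_eq h
  obtain ⟨h1 | h1, h2 | h2⟩ := Idx.cls_eq_cls.mp h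
  · exact absurd hn h1.ne
  · exact absurd hn h1.ne
  · exact absurd hn h2.ne'
  · exact le_antisymm h1.2 h2.2

end Classes

theorem norm_eig_pos (z : L.eigs) : 0 < ‖(z : ℂ)‖ := norm_pos_iff.mpr (L.eig_ne_zero z)

theorem coe_gam (z : L.eigs) : (L.gam z : ℂ) = (z : ℂ) / (‖(z : ℂ)‖ : ℂ) := rfl

/-- The growth rate `binom(m, i) |λ|ᵐ` of the class of the index `p`. -/
noncomputable def scale (p : L.Idx) (m : ℕ) : ℝ := m.choose p.exp * ‖(p.eig : ℂ)‖ ^ m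

theorem scale_pos (p : L.Idx) {m : ℕ} (hm : p.exp ≤ m) : 0 < L.scale p m := by
  have := L.norm_eig_pos p.eig
  have : 0 < m.choose p.exp := Nat.choose_pos hm
  unfold scale
  positivity

theorem tendsto_scale_div (p : L.Idx) (k : ℕ) :
    Tendsto (fun m => L.scale p (m + k) / L.scale p m) atTop (𝓝 (‖(p.eig : ℂ)‖ ^ k)) := by
  have h := (tendsto_choose_add_div_choose p.exp k).mul_const (‖(p.eig : ℂ)‖ ^ k)
  rw [one_mul] at h
  refine h.congr' (Eventually.of_forall fun m => ?_)
  have := (L.norm_eig_pos p.eig).ne'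
  simp only [scale, pow_add]
  field_simp

theorem tendsto_term_div_scale {p q : L.Idx} (h : q < p) :
    Tendsto (fun m : ℕ => ((m.choose q.exp : ℂ) * (q.eig : ℂ) ^ m) / (L.scale p m : ℂ))
      atTop (𝓝 0) := by
  rw [tendsto_zero_iff_norm_tendsto_zero]
  have hc : ∀ m : ℕ, ‖((m.choose q.exp : ℂ) * (q.eig : ℂ) ^ m) / (L.scale p m : ℂ)‖ =
      (m.choose q.exp * ‖(q.eig : ℂ)‖ ^ m) / (m.choose p.exp * ‖(p.eig : ℂ)‖ ^ m) := by
    intro m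
    simp [scale]
  simp only [hc]
  rcases h.le with h1 | ⟨h1, h2⟩
  · exact tendsto_choose_mul_pow_div_of_lt (norm_nonneg _) h1 _ _
  · have h3 : q.exp < p.exp :=
      lt_of_le_of_ne h2 fun he => h.not_ge (Or.inr ⟨h1.symm, he.ge⟩)
    refine (tendsto_choose_div_choose_of_lt h3).congr fun m => ?_
    have := (L.norm_eig_pos p.eig).ne'
    rw [h1]
    field_simp

theorem term_div_scale {p q : L.Idx} (h : q.cls = p.cls) {m : ℕ} (hm : p.exp ≤ m) :
    ((m.choose q.exp : ℂ) * (q.eig : ℂ) ^ m) / (L.scale p m : ℂ) = (L.gam q.eig : ℂ) ^ m := by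
  have h1 : (m.choose p.exp : ℂ) ≠ 0 := by exact_mod_cast (Nat.choose_pos hm).ne'
  rw [coe_gam, scale, ← Idx.exp_eq_of_cls_eq h, ← Idx.norm_eq_of_cls_eq h] at *
  push_cast
  rw [mul_div_mul_left _ _ h1, div_pow]

open Classical in
/-- The complex number whose real part is `Φ_E (x, μ)`. -/
noncomputable def complexPhi (E : L.IdxClass) (x : Fin n → ℝ) (μ : L.eigs → Circle) : ℂ :=
  ∑ p : L.Idx with p.cls = E, L.coeff p x * (μ p.eig : ℂ)

theorem re_complexPhi (E : L.IdxClass) (x : Fin n → ℝ) (μ : L.eigs → Circle) :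
    (L.complexPhi E x μ).re = L.Phi E x μ := rfl

theorem continuous_complexPhi (E : L.IdxClass) (x : Fin n → ℝ) :
    Continuous (L.complexPhi E x) := by
  unfold complexPhi
  fun_prop

theorem continuous_Phi (E : L.IdxClass) (x : Fin n → ℝ) : Continuous (L.Phi E x) :=
  Complex.continuous_re.comp (L.continuous_complexPhi E x)

/-- Along the orbit of `x`, the guard divided by the growth rate of a dominant class is
asymptotic to `Φ` evaluated at the powers of `γ`. -/
theorem tendsto_guard_div_scale_sub {p : L.Idx} {x : Fin n → ℝ} (hp : L.IsDominant p.cls x) :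
    Tendsto (fun m => (L.guard (L.update^[m] x) : ℂ) / (L.scale p m : ℂ) -
      L.complexPhi p.cls x (L.gam ^ m)) atTop (𝓝 0) := by
  classical
  have h : Tendsto (fun m : ℕ => ∑ q : L.Idx,
      (((m.choose q.exp : ℂ) * (q.eig : ℂ) ^ m) / (L.scale p m : ℂ) * L.coeff q x -
        if q.cls = p.cls then L.coeff q x * ((L.gam ^ m) q.eig : ℂ) else 0)) atTop
      (𝓝 (∑ q : L.Idx, 0)) := by
    refine tendsto_finsetSum _ fun q _ => ?_
    -- Terms of the class cancel exactly once the binomial is non-zero; higher terms vanish by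
    -- dominance; lower terms grow more slowly than the scale.
    by_cases hq : q.cls = p.cls
    · refine tendsto_const_nhds.congr' ?_
      filter_upwards [eventually_ge_atTop p.exp] with m hm
      rw [L.term_div_scale hq hm, if_pos hq]
      simp only [Pi.pow_apply, Circle.coe_pow]
      ring
    · simp only [if_neg hq, sub_zero]
      rcases Idx.lt_or_le p q with h1 | h1
      · simp [hp q (Idx.cls_lt_cls.mpr h1)]
      · have h2 : q < p := lt_of_le_not_ge h1 fun h2 => hq (Idx.cls_eq_cls.mpr ⟨h1, h2⟩)
        simpa using (L.tendsto_term_div_scale h2).mul_const (L.coeff q x)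
  rw [Finset.sum_const_zero] at h
  refine h.congr' ?_
  filter_upwards [eventually_ge_atTop n] with m hm
  rw [L.coeff_isExpansion x m hm, complexPhi, Finset.sum_filter, Finset.sum_sub_distrib,
    Finset.sum_div]
  congr 1
  exact Finset.sum_congr rfl fun q _ => by ring

theorem mapClusterPt_gam_pow {μ : L.eigs → Circle} (hμ : μ ∈ L.torus) :
    MapClusterPt μ atTop (fun m : ℕ => L.gam ^ m) :=
  Circle.mapClusterPt_pow fun v hv => hμ v hv

theorem mapClusterPt_guard_div_scale {p : L.Idx} {x : Fin n → ℝ} (hp : L.IsDominant p.cls x)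
    {μ : L.eigs → Circle} (hμ : μ ∈ L.torus) :
    MapClusterPt (L.complexPhi p.cls x μ) atTop
      (fun m => (L.guard (L.update^[m] x) : ℂ) / (L.scale p m : ℂ)) := by
  -- Along an ultrafilter the cluster point is a genuine limit, to which the vanishing error can be
  -- added.
  obtain ⟨U, hU, h⟩ := mapClusterPt_iff_ultrafilter.mp (L.mapClusterPt_gam_pow hμ)
  refine mapClusterPt_iff_ultrafilter.mpr ⟨U, hU, ?_⟩
  have h1 := ((L.continuous_complexPhi p.cls x).tendsto μ).comp h
  simpa [Function.comp_def] using h1.add ((L.tendsto_guard_div_scale_sub hp).mono_left hU)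

end AffineLoop
-- Cluster values on the torus and the averaging argument
namespace AffineLoop

variable {n : ℕ} (L : AffineLoop n)

/-- On the torus, the complex sum of a dominant class is real. -/
theorem im_complexPhi {p : L.Idx} {x : Fin n → ℝ} (hp : L.IsDominant p.cls x)
    {μ : L.eigs → Circle} (hμ : μ ∈ L.torus) : (L.complexPhi p.cls x μ).im = 0 := by
  have hcl : IsClosed {z : ℂ | z.im = 0} := isClosed_eq Complex.continuous_im continuous_const
  refine hcl.mem_of_mapClusterPt (L.mapClusterPt_guard_div_scale hp hμ)
    (Eventually.of_forall fun m => ?_)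
  simp [← Complex.ofReal_div]

theorem Phi_nonneg_of_not_isTerminating {p : L.Idx} {x : Fin n → ℝ}
    (hp : L.IsDominant p.cls x) (hx : ¬ L.IsTerminating x) {μ : L.eigs → Circle}
    (hμ : μ ∈ L.torus) : 0 ≤ L.Phi p.cls x μ := by
  have hcl : IsClosed {z : ℂ | 0 ≤ z.re} := isClosed_le continuous_const Complex.continuous_re
  refine hcl.mem_of_mapClusterPt (L.mapClusterPt_guard_div_scale hp hμ)
    (Eventually.of_forall fun m => ?_)
  have h1 : 0 ≤ L.guard (L.update^[m] x) := not_lt.mp fun h => hx ⟨m, h⟩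
  have h2 : 0 ≤ L.scale p m := by unfold scale; positivity
  simpa [← Complex.ofReal_div] using div_nonneg h1 h2

theorem mem_PN_of_not_isTerminating {x : Fin n → ℝ} (hx : ¬ L.IsTerminating x) : x ∈ L.PN := by
  intro E hE
  obtain ⟨p, rfl⟩ : ∃ p : L.Idx, p.cls = E := Quotient.exists_rep E
  exact Real.iInf_nonneg fun μ => L.Phi_nonneg_of_not_isTerminating hE hx μ.2

theorem isClosed_torus : IsClosed L.torus := by
  have : L.torus = ⋂ v ∈ L.relations, {μ : L.eigs → Circle | ∏ z, μ z ^ v z = 1} := by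
    ext μ; simp [torus]
  rw [this]
  exact isClosed_biInter fun v _ => isClosed_eq
    (continuous_finsetProd _ fun z _ => (continuous_apply z).zpow (v z)) continuous_const

theorem isCompact_torus : IsCompact L.torus := L.isClosed_torus.isCompact

theorem gam_pow_mem_torus (m : ℕ) : L.gam ^ m ∈ L.torus := by
  intro v hv
  have h : ∏ z, L.gam z ^ v z = 1 := hv
  simp only [Pi.pow_apply]
  rw [← one_pow m, ← h, ← Finset.prod_pow]
  refine Finset.prod_congr rfl fun z _ => ?_
  rw [← zpow_natCast, ← zpow_natCast, ← _root_.zpow_mul, ← _root_.zpow_mul, mul_comm]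

theorem mul_mem_torus {μ ν : L.eigs → Circle} (hμ : μ ∈ L.torus) (hν : ν ∈ L.torus) :
    μ * ν ∈ L.torus := by
  intro v hv
  simp only [Pi.mul_apply, mul_zpow, Finset.prod_mul_distrib, hμ v hv, hν v hv, mul_one]

theorem div_mem_torus {μ ν : L.eigs → Circle} (hμ : μ ∈ L.torus) (hν : ν ∈ L.torus) :
    μ / ν ∈ L.torus := by
  intro v hv
  simp only [Pi.div_apply, div_zpow, Finset.prod_div_distrib, hμ v hv, hν v hv, div_one]

/-- Compactness of the torus bounds `Φ` below, so the infimum in `PN` is genuine and not the default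
value 0 of an unbounded real infimum. -/
theorem Phi_nonneg_of_mem_PN {x : Fin n → ℝ} (hx : x ∈ L.PN) {E : L.IdxClass}
    (hE : L.IsDominant E x) {μ : L.eigs → Circle} (hμ : μ ∈ L.torus) : 0 ≤ L.Phi E x μ := by
  refine (hx E hE).trans (ciInf_le (f := fun μ : L.torus => L.Phi E x μ) ?_ ⟨μ, hμ⟩)
  have := (L.isCompact_torus.image (L.continuous_Phi E x)).bddBelow
  rwa [Set.image_eq_range] at this

/-- The coefficients of a class are determined by its sums at the powers of `γ`. -/
theorem coeff_eq_zero_of_complexPhi_eq_zero {p : L.Idx} {x : Fin n → ℝ}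
    (h : ∀ m : ℕ, L.complexPhi p.cls x (L.gam ^ m) = 0) : L.coeff p x = 0 := by
  classical
  -- Extending the coefficients of the class by zero gives an exponential polynomial equal to
  -- `scale` times the class sum, hence zero for `m ≥ p.exp`; linear independence applies.
  let d : ℕ → ℂ → ℂ := fun i z =>
    if hq : i < L.kmax ∧ z ∈ L.eigs then
      if Idx.cls (L := L) ((⟨i, hq.1⟩, ⟨z, hq.2⟩) : Fin L.kmax × L.eigs) = p.cls then
        L.coeff ((⟨i, hq.1⟩, ⟨z, hq.2⟩) : Fin L.kmax × L.eigs) x else 0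
    else 0
  have hd : ∀ q : L.Idx, d q.exp q.eig = if q.cls = p.cls then L.coeff q x else 0 := by
    intro q
    have hq : q.exp < L.kmax ∧ (q.eig : ℂ) ∈ L.eigs := ⟨(Prod.fst q : Fin L.kmax).2, q.eig.2⟩
    simp only [d, dif_pos hq]
    rfl
  have key := expansion_coeff_eq_zero L.eigs (by simp [eigs]) p.exp L.kmax d (fun m hm => by
    rw [← L.sum_idx (fun i z => (m.choose i : ℂ) * z ^ m * d i z)]
    have h1 : ∀ q : L.Idx, (m.choose q.exp : ℂ) * (q.eig : ℂ) ^ m * d q.exp q.eig =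
        L.scale p m * if q.cls = p.cls then L.coeff q x * ((L.gam ^ m) q.eig : ℂ) else 0 := by
      intro q
      rw [hd]
      split_ifs with hq
      · have hs : (L.scale p m : ℂ) ≠ 0 := by exact_mod_cast (L.scale_pos p hm).ne'
        have := L.term_div_scale hq hm
        rw [div_eq_iff hs] at this
        rw [this]
        simp only [Pi.pow_apply, Circle.coe_pow]
        ring
      · simp
    simp only [h1]
    rw [← Finset.mul_sum, ← Finset.sum_filter]
    have := h m
    rw [complexPhi] at this
    rw [this, mul_zero])
  have := key p.eig p.eig.2 p.exp (Prod.fst p : Fin L.kmax).2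
  rwa [hd, if_pos rfl] at this

/-- If a dominant class of `x` has non-negative `Φ` on the torus and a non-zero coefficient, then
finitely many translates of `Φ` by powers of `γ` have no common zero on the torus. -/
theorem exists_forall_exists_Phi_pos {p : L.Idx} {x : Fin n → ℝ} (hp : L.IsDominant p.cls x)
    (hpos : ∀ μ ∈ L.torus, 0 ≤ L.Phi p.cls x μ) (hne : L.coeff p x ≠ 0) :
    ∃ K : ℕ, ∀ μ ∈ L.torus, ∃ k < K, 0 < L.Phi p.cls x (L.gam ^ k * μ) := by
  obtain ⟨μ₁, hμ₁, hμ₁'⟩ : ∃ μ ∈ L.torus, 0 < L.Phi p.cls x μ := by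
    by_contra! hcon
    refine hne (L.coeff_eq_zero_of_complexPhi_eq_zero fun m => Complex.ext ?_ ?_)
    · exact le_antisymm (hcon _ (L.gam_pow_mem_torus m)) (hpos _ (L.gam_pow_mem_torus m))
    · exact L.im_complexPhi hp (L.gam_pow_mem_torus m)
  have hcont : ∀ k : ℕ, Continuous fun μ => L.Phi p.cls x (L.gam ^ k * μ) := fun k =>
    (L.continuous_Phi _ x).comp (continuous_const.mul continuous_id)
  obtain ⟨t, ht⟩ := L.isCompact_torus.elim_finite_subcover
    (fun k : ℕ => {μ | 0 < L.Phi p.cls x (L.gam ^ k * μ)})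
    (fun k => isOpen_lt continuous_const (hcont k)) (fun μ hμ => by
      -- Some power `γ^k` is close to `μ₁ / μ`, which moves `μ` near the point `μ₁` where `Φ` is
      -- positive.
      have h1 := (L.mapClusterPt_gam_pow (L.div_mem_torus hμ₁ hμ)).continuousAt_comp
        (f := fun ν => L.Phi p.cls x (ν * μ))
        ((L.continuous_Phi _ x).comp (continuous_id.mul continuous_const)).continuousAt
      obtain ⟨k, hk⟩ := (h1.frequently (lt_mem_nhds (by simpa using hμ₁'))).exists
      exact Set.mem_iUnion.mpr ⟨k, hk⟩)
  refine ⟨t.sup id + 1, fun μ hμ => ?_⟩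
  obtain ⟨k, hk, hk'⟩ := Set.mem_iUnion₂.mp (ht hμ)
  exact ⟨k, Nat.lt_succ_of_le (Finset.le_sup (f := id) hk), hk'⟩

/-- A sum of guards along shifted orbits is eventually positive, provided that the corresponding
sum of translates of `Φ` is positive on the torus. -/
theorem eventually_sum_guard_pos {p : L.Idx} {x : Fin n → ℝ} (hp : L.IsDominant p.cls x) (K : ℕ)
    (hpos : ∀ μ ∈ L.torus,
      0 < ∑ k ∈ Finset.range K, ‖(p.eig : ℂ)‖ ^ k * L.Phi p.cls x (L.gam ^ k * μ)) :
    ∀ᶠ m in atTop, 0 < ∑ k ∈ Finset.range K, L.guard (L.update^[m + k] x) := by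
  set S : (L.eigs → Circle) → ℝ := fun μ =>
    ∑ k ∈ Finset.range K, ‖(p.eig : ℂ)‖ ^ k * L.Phi p.cls x (L.gam ^ k * μ) with hS
  have hScont : Continuous S := continuous_finsetSum _ fun k _ =>
    continuous_const.mul ((L.continuous_Phi _ x).comp (continuous_const.mul continuous_id))
  obtain ⟨μ₀, hμ₀, hmin⟩ := L.isCompact_torus.exists_isMinOn
    ⟨_, L.gam_pow_mem_torus 0⟩ hScont.continuousOn
  have hre : Tendsto (fun m => L.guard (L.update^[m] x) / L.scale p m -
      L.Phi p.cls x (L.gam ^ m)) atTop (𝓝 0) := by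
    have := (Complex.continuous_re.tendsto _).comp (L.tendsto_guard_div_scale_sub hp)
    simpa [Function.comp_def, ← Complex.ofReal_div, re_complexPhi] using this
  obtain ⟨C, hC⟩ : ∃ C, ∀ m : ℕ, |L.Phi p.cls x (L.gam ^ m)| ≤ C := by
    obtain ⟨C, hC⟩ := L.isCompact_torus.exists_bound_of_continuousOn
      (L.continuous_Phi p.cls x).continuousOn
    exact ⟨C, fun m => hC _ (L.gam_pow_mem_torus m)⟩
  have hlim : Tendsto (fun m => ∑ k ∈ Finset.range K,
      (L.guard (L.update^[m + k] x) / L.scale p m -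
        ‖(p.eig : ℂ)‖ ^ k * L.Phi p.cls x (L.gam ^ k * L.gam ^ m))) atTop
      (𝓝 (∑ k ∈ Finset.range K, 0)) := by
    refine tendsto_finsetSum _ fun k _ => ?_
    have h1 := hre.comp (tendsto_add_atTop_nat k)
    -- The error splits in two: the asymptotic error at `m + k`, rescaled, and the deviation of
    -- `scale p (m + k) / scale p m` from `|λ|^k`, multiplied by a bounded value of `Φ`.
    have h2 := (L.tendsto_scale_div p k).mul h1
    have h3 : Tendsto (fun m => (L.scale p (m + k) / L.scale p m - ‖(p.eig : ℂ)‖ ^ k) *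
        L.Phi p.cls x (L.gam ^ (m + k))) atTop (𝓝 0) := by
      refine Tendsto.zero_mul_isBoundedUnder_le ?_
        ⟨C, eventually_map.mpr (Eventually.of_forall fun m => hC (m + k))⟩
      simpa using (L.tendsto_scale_div p k).sub_const (‖(p.eig : ℂ)‖ ^ k)
    have h4 := h2.add h3
    rw [mul_zero, add_zero] at h4
    refine h4.congr' ?_
    filter_upwards [eventually_ge_atTop p.exp] with m hm
    have e1 := (L.scale_pos p hm).ne'
    have e2 := (L.scale_pos p (hm.trans (Nat.le_add_right m k))).ne'
    rw [← pow_add, add_comm k m]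
    simp only [Function.comp]
    field_simp
    ring
  rw [Finset.sum_const_zero] at hlim
  filter_upwards [hlim.eventually (lt_mem_nhds (neg_lt_zero.mpr (hpos μ₀ hμ₀))),
    eventually_ge_atTop p.exp] with m hm hm'
  rw [Finset.sum_sub_distrib, ← Finset.sum_div] at hm
  have h1 : S μ₀ ≤ S (L.gam ^ m) := hmin (L.gam_pow_mem_torus m)
  simp only [hS] at h1
  exact (div_pos_iff_of_pos_right (L.scale_pos p hm')).mp (by linarith)

/-- Finiteness of the index set yields a maximal index with non-zero coefficient; its class is the
least dominant one. -/
theorem exists_maximal_coeff_ne_zero {x : Fin n → ℝ} (h : ∃ p : L.Idx, L.coeff p x ≠ 0) :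
    ∃ p : L.Idx, L.coeff p x ≠ 0 ∧ L.IsDominant p.cls x := by
  obtain ⟨p, hp⟩ := (Set.toFinite {p : L.Idx | L.coeff p x ≠ 0}).exists_maximal h
  refine ⟨p, hp.prop, fun q hq => ?_⟩
  by_contra hne
  exact hp.not_gt hne (Idx.cls_lt_cls.mp hq)

theorem nonTerminatingOver_of_mem_PN {D : Subring ℝ} (hD : ∀ q : ℚ, (q : ℝ) ∈ D)
    {x : Fin n → ℝ} (hxD : ∀ i, x i ∈ D) (hx : x ∈ L.PN) : L.NonTerminatingOver D := by
  by_cases hne : ∃ p : L.Idx, L.coeff p x ≠ 0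
  · obtain ⟨p, hp, hdom⟩ := L.exists_maximal_coeff_ne_zero hne
    have hpos : ∀ μ ∈ L.torus, 0 ≤ L.Phi p.cls x μ := fun μ hμ =>
      L.Phi_nonneg_of_mem_PN hx hdom hμ
    obtain ⟨K, hK⟩ := L.exists_forall_exists_Phi_pos hdom hpos hp
    have hK0 : (K : ℝ) ≠ 0 := by
      obtain ⟨k, hk, -⟩ := hK _ (L.gam_pow_mem_torus 0)
      exact_mod_cast (Nat.zero_lt_of_lt hk).ne'
    have hw : ∑ k ∈ Finset.range K, ((K : ℝ)⁻¹) = 1 := by simp [hK0]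
    have hev := L.eventually_sum_guard_pos hdom K fun μ hμ => by
      obtain ⟨k, hk, hk'⟩ := hK μ hμ
      exact Finset.sum_pos' (fun j _ => mul_nonneg (by positivity)
          (hpos _ (L.mul_mem_torus (L.gam_pow_mem_torus j) hμ)))
        ⟨k, Finset.mem_range.mpr hk, mul_pos (pow_pos (L.norm_eig_pos _) _) hk'⟩
    -- The witness is the barycentre of the first `K` orbit points; the weight `1/K` is rational, so
    -- it stays over `D`.
    refine L.nonTerminatingOver_of_eventually hD
      (x := ∑ k ∈ Finset.range K, (K : ℝ)⁻¹ • L.update^[k] x) (fun i => ?_) ?_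
    · rw [Finset.sum_apply]
      refine D.sum_mem fun k _ => D.mul_mem ?_ (L.iterate_update_mem hD hxD k i)
      simpa using hD (K : ℚ)⁻¹
    · filter_upwards [hev] with m hm
      rw [L.iterate_update_sum_smul _ _ hw, L.guard_sum_smul _ _ hw, ← Finset.mul_sum]
      simp only [← Function.iterate_add_apply]
      positivity
  · push Not at hne
    refine L.nonTerminatingOver_of_eventually hD hxD ?_
    filter_upwards [eventually_ge_atTop n] with m hm
    have h := L.coeff_isExpansion x m hm
    simp only [hne, mul_zero, Finset.sum_const_zero] at h
    exact (Complex.ofReal_eq_zero.mp h).ge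

/-- Non-termination over a subring that contains the rationals is witnessed by `PN`. -/
theorem nonTerminatingOver_iff {D : Subring ℝ} (hD : ∀ q : ℚ, (q : ℝ) ∈ D) :
    L.NonTerminatingOver D ↔ ∃ x ∈ L.PN, ∀ i, x i ∈ D :=
  ⟨fun ⟨x, hxD, hx⟩ => ⟨x, L.mem_PN_of_not_isTerminating hx, hxD⟩,
    fun ⟨_, hx, hxD⟩ => L.nonTerminatingOver_of_mem_PN hD hxD hx⟩

end AffineLoop

theorem mainTheorem5 {n : ℕ} (L : AffineLoop n) (hL : L.NonDegenerate) :
    (L.NonTerminatingOver ⊤ ↔ L.PN.Nonempty) ∧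
    (L.NonTerminatingOver (Rat.castHom ℝ).range ↔
      ∃ q : Fin n → ℚ, (fun i => (q i : ℝ)) ∈ L.PN) := by
  constructor
  · rw [L.nonTerminatingOver_iff fun _ => Subring.mem_top _]
    simp [Set.Nonempty]
  · rw [L.nonTerminatingOver_iff fun q => RingHom.mem_range.mpr ⟨q, rfl⟩]
    constructor
    · rintro ⟨x, hx, hxD⟩
      choose q hq using hxD
      refine ⟨q, ?_⟩
      have : (fun i => (q i : ℝ)) = x := funext hq
      rwa [this]
    · rintro ⟨q, hq⟩
      exact ⟨_, hq, fun i => ⟨q i, rfl⟩⟩
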